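/- Let $n\ge 1$ and equip $\mathbb{R}^n$ with the coordinatewise order, the sup-norm metric and the action $\lambda\cdot x=(\lambda+x_i)_i$ of the additive group $\mathbb{R}$. An additive cone is a subset of $\mathbb{R}^n$ stable under this action. A closed ambitropical cone is a nonempty closed additive cone that is a lattice for the induced order (not necessarily a sublattice of $\mathbb{R}^n$), and an ambitropical hull of $X\subset\mathbb{R}^n$ is a closed ambitropical cone containing $X$ that is minimal for inclusion among these. A metric space with a real action is a metric space $E$ with an action of $(\mathbb{R},+)$ such that $d(\lambda\cdot x,\lambda'\cdot x)=|\lambda-\lambda'|$ and $d(\lambda\cdot x,\lambda\cdot x')=d(x,x')$. Such a space $C$ is injective if for every metric space with a real action $Y$ and every action-stable $S\subset Y$, every nonexpansive action-preserving map $S\to C$ extends to a nonexpansive action-preserving map $Y\to C$. An injective hull of $X$ is an injective metric space with a real action $H$ together with an action-preserving isometric embedding $j:X\to H$ such that every action-preserving isometric embedding $\iota:X\to Y$ into an injective metric space with a real action is of the form $\iota=\varphi\circ j$ for some action-preserving isometric embedding $\varphi:H\to Y$. The tight span $T(X)$ is the set of functions $f:X\to\mathbb{R}_{\ge 0}$ minimal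 (pointwise) among those with $f(x)+f(y)\ge d(x,y)$ for all $x,y\in X$, with the metric $d_\infty(f,g)=\sup_x|f(x)-g(x)|$, the action $(\lambda\cdot f)(y)=f((-\lambda)\cdot y)$ and the map $e:X\to T(X)$, $e(x)=d(x,\cdot)$. For nonempty $E\subset\mathbb{R}^n$, let $E^{\max}$ be the set of all $\sup_{f\in E}(\lambda_f+f)$ with $\lambda_f\in\mathbb{R}\cup\{-\infty\}$ not all $-\infty$ and the family bounded from above; let $E^{\min}$ be the set of all $\inf_{f\in E}(\lambda_f+f)$ with $\lambda_f\in\mathbb{R}\cup\{+\infty\}$ not all $+\infty$ and the family bounded from below. Put $P^{\max}_E(x)=\sup\{y\in E^{\max}: y\le x\}$ and $P^{\min}_E(x)=\inf\{y\in E^{\min}: y\ge x\}$. **Theorem.** Let $X\subset\mathbb{R}^n$ be a nonempty additive cone. Then: 1. $(T(X),e)$ is an injective hull of $X$. 2. For every ambitropical hull $A$ of $X$ there is a bijective action-preserving isometry $\varphi:T(X)\to A$ with $\varphi(e(x))=x$ for all $x\in X$. More generally, for every ambitropical hull $A$ and every injective hull $(H,j)$ of $X$ there is a bijective action-preserving isometry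 $\varphi:H\to A$ with $\varphi(j(x))=x$ for all $x\in X$. 3. The ranges of $P^{\max}_X\circ P^{\min}_X$ and of $P^{\min}_X\circ P^{\max}_X$ are ambitropical hulls of $X$; hence they are explicit realizations of the injective (hyperconvex) hull of $X$. -/

import Mathlib

universe v u w

/-! ### Cones in `ℝⁿ`

`Fin n → ℝ` carries the coordinatewise order, the sup-norm metric, and the action of the additive
group `ℝ` given by `(r +ᵥ x) i = r + x i`. -/

/-- An additive cone of `ℝⁿ`: a subset stable under adding a real constant to all coordinates. -/
abbrev AdditiveCone (n : ℕ) := SubAddAction ℝ (Fin n → ℝ)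

/-- A nonempty additive cone which is a lattice for the order induced by `ℝⁿ`
(not necessarily a sublattice of `ℝⁿ`). -/
structure IsAmbitropicalCone {n : ℕ} (C : Set (Fin n → ℝ)) : Prop where
  nonempty : C.Nonempty
  vadd_mem : ∀ (r : ℝ), ∀ x ∈ C, r +ᵥ x ∈ C
  exists_sup : ∀ x ∈ C, ∀ y ∈ C, ∃ z, IsLeast {w | w ∈ C ∧ x ≤ w ∧ y ≤ w} z
  exists_inf : ∀ x ∈ C, ∀ y ∈ C, ∃ z, IsGreatest {w | w ∈ C ∧ w ≤ x ∧ w ≤ y} z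

/-- `A` is an ambitropical hull of `E`: a closed ambitropical cone containing `E`, minimal for
inclusion among those. -/
def IsAmbitropicalHull {n : ℕ} (E A : Set (Fin n → ℝ)) : Prop :=
  Minimal (fun C : Set (Fin n → ℝ) => IsAmbitropicalCone C ∧ IsClosed C ∧ E ⊆ C) A

/-- The set `E^max` of suprema `sup {c_f + f | f ∈ E}` of families that are bounded from above,
where `c_f ∈ ℝ ∪ {-∞}` are not all `-∞`; `S` is the set of the `f ∈ E` with `c_f ≠ -∞`. -/
def maxSpan {n : ℕ} (E : Set (Fin n → ℝ)) : Set (Fin n → ℝ) :=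
  {x | ∃ S ⊆ E, S.Nonempty ∧ ∃ c : (Fin n → ℝ) → ℝ, IsLUB ((fun f => c f +ᵥ f) '' S) x}

/-- The set `E^min` of infima `inf {c_f + f | f ∈ E}` of families that are bounded from below,
where `c_f ∈ ℝ ∪ {+∞}` are not all `+∞`; `S` is the set of the `f ∈ E` with `c_f ≠ +∞`. -/
def minSpan {n : ℕ} (E : Set (Fin n → ℝ)) : Set (Fin n → ℝ) :=
  {x | ∃ S ⊆ E, S.Nonempty ∧ ∃ c : (Fin n → ℝ) → ℝ, IsGLB ((fun f => c f +ᵥ f) '' S) x}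

/-- The tropical projection `x ↦ sup {y ∈ E^max | y ≤ x}` (coordinatewise supremum; the set is
nonempty and bounded above as soon as `E` is nonempty). -/
noncomputable def projMax {n : ℕ} (E : Set (Fin n → ℝ)) (x : Fin n → ℝ) : Fin n → ℝ :=
  sSup {y | y ∈ maxSpan E ∧ y ≤ x}

/-- The dual tropical projection `x ↦ inf {y ∈ E^min | y ≥ x}`. -/
noncomputable def projMin {n : ℕ} (E : Set (Fin n → ℝ)) (x : Fin n → ℝ) : Fin n → ℝ :=
  sInf {y | y ∈ minSpan E ∧ x ≤ y}

/-! ### Metric spaces with a real action -/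

/-- The two axioms of a metric space with a real action. -/
class IsRealActionSpace (E : Type*) [MetricSpace E] [AddAction ℝ E] : Prop where
  dist_vadd_vadd_same : ∀ (r s : ℝ) (x : E), dist (r +ᵥ x) (s +ᵥ x) = |r - s|
  dist_vadd : ∀ (r : ℝ) (x y : E), dist (r +ᵥ x) (r +ᵥ y) = dist x y

instance AdditiveCone.isRealActionSpace {n : ℕ} [NeZero n] (X : AdditiveCone n) :
    IsRealActionSpace X where
  dist_vadd_vadd_same r s x := by
    rw [Subtype.dist_eq]
    apply le_antisymm
    · rw [dist_pi_le_iff (abs_nonneg _)]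
      intro i
      simp [Real.dist_eq]
    · have h := dist_le_pi_dist ((r +ᵥ x : X) : Fin n → ℝ) ((s +ᵥ x : X) : Fin n → ℝ) 0
      simpa [Real.dist_eq] using h
  dist_vadd r x y := by
    rw [Subtype.dist_eq, Subtype.dist_eq]
    simp [dist_pi_def, nndist_dist]

/-- Maps commuting with the real actions. -/
def IsActionPreserving {E F : Type*} [AddAction ℝ E] [AddAction ℝ F] (f : E → F) : Prop :=
  ∀ (r : ℝ) (x : E), f (r +ᵥ x) = r +ᵥ f x

/-- `C` is injective among metric spaces with a real action: every nonexpansive action-preserving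
map to `C`, defined on a subset (stable under the action) of a metric space with a real action,
extends to a nonexpansive action-preserving map on the whole space. -/
def IsInjectiveActionSpace (C : Type u) [MetricSpace C] [AddAction ℝ C] : Prop :=
  ∀ (Y : Type v) [MetricSpace Y] [AddAction ℝ Y] [IsRealActionSpace Y] (S : SubAddAction ℝ Y)
    (f : S → C), LipschitzWith 1 f → IsActionPreserving f →
      ∃ g : Y → C, LipschitzWith 1 g ∧ IsActionPreserving g ∧ ∀ s : S, g s = f s

/-- `j : X → H` exhibits `H` as the injective hull of `X` among metric spaces with a real action:
`H` is injective, `j` is an action-preserving isometric embedding, and every action-preserving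
isometric embedding of `X` in an injective space `Y` factors as an action-preserving isometric
embedding of `H` in `Y` after `j`. -/
structure IsInjectiveHull {X : Type w} [MetricSpace X] [AddAction ℝ X]
    {H : Type u} [MetricSpace H] [AddAction ℝ H] (j : X → H) : Prop where
  isRealActionSpace : IsRealActionSpace H
  isInjective : IsInjectiveActionSpace.{v, u} H
  isometry : Isometry j
  isActionPreserving : IsActionPreserving j
  exists_factor : ∀ (Y : Type v) [MetricSpace Y] [AddAction ℝ Y] [IsRealActionSpace Y],
    IsInjectiveActionSpace.{v, v} Y → ∀ i : X → Y, Isometry i → IsActionPreserving i →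
      ∃ φ : H → Y, Isometry φ ∧ IsActionPreserving φ ∧ i = φ ∘ j

/-! ### The tight span -/

/-- The tight span `T(X)`: the minimal functions among the `f : X → ℝ` with
`d(x, y) ≤ f x + f y` for all `x, y`. (Such functions are nonnegative: take `y = x`.) -/
def TightSpan (X : Type*) [MetricSpace X] : Type _ :=
  {f : X → ℝ // Minimal (fun g : X → ℝ => ∀ x y, dist x y ≤ g x + g y) f}

namespace TightSpan

section Metric

variable {X : Type*} [MetricSpace X]

instance : FunLike (TightSpan X) X ℝ where
  coe f := f.1
  coe_injective := Subtype.val_injective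

theorem dist_le (f : TightSpan X) (x y : X) : dist x y ≤ f x + f y := f.2.prop x y

theorem nonneg (f : TightSpan X) (x : X) : 0 ≤ f x := by
  have := f.dist_le x x
  rw [dist_self] at this
  linarith

/-- Elements of the tight span are 1-Lipschitz. -/
theorem le_add_dist (f : TightSpan X) (x y : X) : f x ≤ f y + dist x y := by
  classical
  by_contra! h
  have hg : ∀ a b, dist a b ≤
      Function.update (f : X → ℝ) x (f y + dist x y) a +
        Function.update (f : X → ℝ) x (f y + dist x y) b := by
    intro a b
    have h0 := f.nonneg y
    have h1 : (0 : ℝ) ≤ dist x y := dist_nonneg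
    have key : ∀ c, dist x c ≤ f y + dist x y + f c := fun c => by
      linarith [dist_triangle x y c, f.dist_le y c]
    by_cases ha : a = x <;> by_cases hb : b = x
    · subst ha; subst hb; simp; linarith
    · subst ha; simpa [hb] using key b
    · subst hb; simpa [ha, dist_comm, add_comm] using key a
    · simpa [ha, hb] using f.dist_le a b
  have hle : Function.update (f : X → ℝ) x (f y + dist x y) ≤ (f : X → ℝ) := by
    intro a
    by_cases ha : a = x
    · subst ha; simpa using h.le
    · simp [ha]
  have := f.2.2 hg hle x
  simp at this
  exact absurd this (not_le.mpr h)

theorem bddAbove_abs_sub (f g : TightSpan X) : BddAbove (Set.range fun x => |f x - g x|) := by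
  rcases isEmpty_or_nonempty X with _ | ⟨⟨o⟩⟩
  · simp
  · refine ⟨f o + g o, ?_⟩
    rintro _ ⟨x, rfl⟩
    have h1 := f.le_add_dist x o
    have h2 := g.le_add_dist x o
    have h3 := f.dist_le x o
    have h4 := g.dist_le x o
    exact abs_le.mpr ⟨by linarith, by linarith⟩

/-- The supremum distance `d_∞(f, g) = sup_x |f x - g x|`. -/
noncomputable instance : MetricSpace (TightSpan X) where
  dist f g := ⨆ x, |f x - g x|
  dist_self f := by simp
  dist_comm f g := by simp only [abs_sub_comm]
  dist_triangle f g h := by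
    refine Real.iSup_le (fun x => ?_) (add_nonneg (Real.iSup_nonneg fun _ => abs_nonneg _)
      (Real.iSup_nonneg fun _ => abs_nonneg _))
    exact (abs_sub_le (f x) (g x) (h x)).trans
      (add_le_add (le_ciSup (bddAbove_abs_sub f g) x) (le_ciSup (bddAbove_abs_sub g h) x))
  eq_of_dist_eq_zero {f g} h := by
    refine DFunLike.ext _ _ fun x => ?_
    have h1 : |f x - g x| ≤ ⨆ x, |f x - g x| := le_ciSup (bddAbove_abs_sub f g) x
    have h2 : |f x - g x| ≤ 0 := h1.trans h.le
    exact sub_eq_zero.mp (abs_nonpos_iff.mp h2)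

theorem dist_def (f g : TightSpan X) : dist f g = ⨆ x, |f x - g x| := rfl

/-- The canonical map `e(x) = d(x, ·)` from `X` to its tight span. -/
def embed (x : X) : TightSpan X :=
  ⟨fun y => dist x y, fun a b => dist_triangle_left a b x, fun g hg hle y => by
    have h1 := hg x y
    have h2 : g x ≤ dist x x := hle x
    rw [dist_self] at h2
    show dist x y ≤ g y
    linarith⟩

end Metric

/-- The action `(r • f)(y) = f((-r) • y)` on the tight span. -/
instance {X : Type*} [MetricSpace X] [AddAction ℝ X] [IsRealActionSpace X] :
    AddAction ℝ (TightSpan X) where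
  vadd r f := ⟨fun y => f (-r +ᵥ y), fun x y => by
      rw [← IsRealActionSpace.dist_vadd (-r) x y]
      exact f.dist_le _ _, fun g hg hle y => by
      have h := f.2.2 (y := fun z => g (r +ᵥ z))
        (fun a b => by
          rw [← IsRealActionSpace.dist_vadd r a b]
          exact hg _ _)
        (fun z => by
          have h1 : g (r +ᵥ z) ≤ f (-r +ᵥ (r +ᵥ z)) := hle (r +ᵥ z)
          rw [neg_vadd_vadd] at h1
          exact h1) (-r +ᵥ y)
      have h2 : f (-r +ᵥ y) ≤ g (r +ᵥ (-r +ᵥ y)) := h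
      rw [vadd_neg_vadd] at h2
      exact h2⟩
  zero_vadd f := DFunLike.ext _ _ fun y => by
    show f (-(0 : ℝ) +ᵥ y) = f y
    simp
  add_vadd r s f := DFunLike.ext _ _ fun y => by
    show f (-(r + s) +ᵥ y) = f (-s +ᵥ (-r +ᵥ y))
    rw [vadd_vadd, neg_add_rev]

end TightSpan

/-!
Write `P = projMax X` and `Q = projMin X`. Since `X` is a cone, `P x` is the supremum and `Q x` the
infimum of the elements of `X` below, respectively above, `x` (`isLUB_projMax`, `isGLB_projMin`), so
both maps are monotone, commute with the action, and satisfy `P ≤ id ≤ Q`. It follows that `P ∘ Q`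
and `Q ∘ P` are idempotent. A monotone equivariant idempotent map of `ℝⁿ` is nonexpansive, and its
range is a closed ambitropical cone; conversely, every closed ambitropical cone is the range of such
a map (`IsAmbitropicalCone.exists_isConeRetraction`). As `ℝⁿ` is injective by the McShane extension
formula (`exists_equivariant_extension`), all closed ambitropical cones are injective.

The rest is rigidity of `B = range (P ∘ Q)`. If `F` is monotone and fixes `X` pointwise, then
`P y ≤ F y ≤ Q y`, which forces `F y = y` when `y` and `F y` lie in `B`. This yields the minimality
of `B`, and shows that a second hull `A` is the image of `B` under a retraction onto `A`. On the
metric side, the distance from `y` to the far translates of a point `e ∈ X` detects whether `e ≤ y`.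
Hence two points `y`, `z` of `B` satisfy `dist y z ≤ D` as soon as `|dist y x - dist z x| ≤ D` on `X`
(`dist_le_of_forall_dist_le`). So `y ↦ dist y ·` is an isometry on `B`; its image is exactly
`T(X)`, because every function `f` with `dist x x' ≤ f x + f x'` dominates some `dist y ·` with
`y ∈ B`: intersect the balls of radii `f x` in `ℝⁿ` and retract to `B`. Finally, a nonexpansive
self-map of `T(X)` fixing `X` is the identity, by minimality of the elements of `T(X)`; this gives
the universal property of `T(X)` and the surjectivity of the embedding of any other injective hull
into `A`.
-/

/-! ### Retractions on cones of `ℝⁿ` -/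

/-- `R` is a monotone retraction of `ℝⁿ` on `C` commuting with the action of `ℝ`. -/
structure IsConeRetraction {n : ℕ} (R : (Fin n → ℝ) → (Fin n → ℝ)) (C : Set (Fin n → ℝ)) :
    Prop where
  monotone : Monotone R
  map_vadd : IsActionPreserving R
  mem : ∀ x, R x ∈ C
  map_eq : ∀ x ∈ C, R x = x

section ConeRetraction

variable {n : ℕ}

/-- For the action of a group, a one-sided inequality suffices for equivariance: apply it to both
`r` and `-r`. -/
theorem isActionPreserving_of_le {R : (Fin n → ℝ) → (Fin n → ℝ)}
    (h : ∀ (r : ℝ) x, R (r +ᵥ x) ≤ r +ᵥ R x) : IsActionPreserving R := by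
  intro r x
  refine le_antisymm (h r x) fun i => ?_
  have h1 := h (-r) (r +ᵥ x) i
  rw [neg_vadd_vadd] at h1
  simp only [Pi.vadd_apply, vadd_eq_add] at h1 ⊢
  linarith

theorem le_dist_vadd (x y : Fin n → ℝ) : x ≤ dist x y +ᵥ y := fun i => by
  have h := (le_abs_self _).trans (dist_le_pi_dist x y i)
  simp only [Pi.vadd_apply, vadd_eq_add]
  linarith

theorem dist_vadd_pi (r : ℝ) (x y : Fin n → ℝ) : dist (r +ᵥ x) (r +ᵥ y) = dist x y := by
  simp [dist_pi_def, nndist_dist]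

theorem dist_vadd_left_eq (r : ℝ) (x y : Fin n → ℝ) : dist (r +ᵥ x) y = dist x (-r +ᵥ y) := by
  rw [← dist_vadd_pi (-r), neg_vadd_vadd]

theorem dist_le_of_le_vadd {x y : Fin n → ℝ} {D : ℝ} (hD : 0 ≤ D) (h : x ≤ D +ᵥ y)
    (h' : y ≤ D +ᵥ x) : dist x y ≤ D := by
  refine (dist_pi_le_iff hD).2 fun i => ?_
  have h1 := h i
  have h2 := h' i
  simp only [Pi.vadd_apply, vadd_eq_add] at h1 h2
  rw [Real.dist_eq, abs_le]
  constructor <;> linarith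

namespace IsConeRetraction

variable {R : (Fin n → ℝ) → (Fin n → ℝ)} {C : Set (Fin n → ℝ)}

theorem of_idem (hm : Monotone R) (hv : IsActionPreserving R) (hi : ∀ x, R (R x) = R x) :
    IsConeRetraction R (Set.range R) where
  monotone := hm
  map_vadd := hv
  mem := Set.mem_range_self
  map_eq := by
    rintro _ ⟨x, rfl⟩
    exact hi x

theorem dist_le (hR : IsConeRetraction R C) (x y : Fin n → ℝ) : dist (R x) (R y) ≤ dist x y := by
  refine dist_le_of_le_vadd dist_nonneg ?_ ?_
  · rw [← hR.map_vadd]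
    exact hR.monotone (le_dist_vadd x y)
  · rw [← hR.map_vadd, dist_comm]
    exact hR.monotone (le_dist_vadd y x)

theorem isClosed (hR : IsConeRetraction R C) : IsClosed C := by
  have hc : Continuous R :=
    (LipschitzWith.of_dist_le_mul (K := 1) fun x y => by simpa using hR.dist_le x y).continuous
  have : C = {x | R x = x} :=
    Set.ext fun x => ⟨hR.map_eq x, fun h => h ▸ hR.mem x⟩
  rw [this]
  exact isClosed_eq hc continuous_id

theorem isAmbitropicalCone (hR : IsConeRetraction R C) : IsAmbitropicalCone C where
  nonempty := ⟨R 0, hR.mem 0⟩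
  vadd_mem r x hx := by
    rw [← hR.map_eq x hx, ← hR.map_vadd]
    exact hR.mem _
  exists_sup x hx y hy := by
    refine ⟨R (x ⊔ y), ⟨hR.mem _, ?_, ?_⟩, fun w hw => ?_⟩
    · simpa only [hR.map_eq x hx] using hR.monotone (le_sup_left : x ≤ x ⊔ y)
    · simpa only [hR.map_eq y hy] using hR.monotone (le_sup_right : y ≤ x ⊔ y)
    · simpa only [hR.map_eq w hw.1] using hR.monotone (sup_le hw.2.1 hw.2.2)
  exists_inf x hx y hy := by
    refine ⟨R (x ⊓ y), ⟨hR.mem _, ?_, ?_⟩, fun w hw => ?_⟩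
    · simpa only [hR.map_eq x hx] using hR.monotone (inf_le_left : x ⊓ y ≤ x)
    · simpa only [hR.map_eq y hy] using hR.monotone (inf_le_right : x ⊓ y ≤ y)
    · simpa only [hR.map_eq w hw.1] using hR.monotone (le_inf hw.2.1 hw.2.2)

end IsConeRetraction

/-- A nonempty closed subset of `ℝⁿ` which is bounded below and directed downwards has a least
element. -/
theorem exists_isLeast_of_directedOn {U : Set (Fin n → ℝ)} (hne : U.Nonempty) (hb : BddBelow U)
    (hc : IsClosed U) (hd : DirectedOn (· ≥ ·) U) : ∃ z, IsLeast U z := by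
  have hz := isGLB_csInf hne hb
  refine ⟨sInf U, ?_, hz.1⟩
  refine hc.closure_subset (Metric.mem_closure_iff.2 ?_)
  intro ε hε
  have key : ∀ i, ∃ w : U, w.1 i < sInf U i + ε / 2 := by
    intro i
    by_contra! h
    have hi : IsGLB (Function.eval i '' U) (sInf U i) := isGLB_pi.1 hz i
    have : sInf U i + ε / 2 ≤ sInf U i := hi.2 (by
      rintro _ ⟨w, hw, rfl⟩
      exact h ⟨w, hw⟩)
    linarith
  choose w hw using key
  have : Nonempty U := hne.to_subtype
  obtain ⟨v, hv⟩ := (directedOn_iff_directed.1 hd).finite_le w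
  refine ⟨v, v.2, ?_⟩
  refine lt_of_le_of_lt (dist_le_of_le_vadd (D := ε / 2) (by positivity) ?_ ?_) (half_lt_self hε)
  · intro i
    have := hz.1 v.2 i
    simp only [Pi.vadd_apply, vadd_eq_add]
    linarith
  · intro i
    have h1 : v.1 i ≤ (w i).1 i := hv i i
    have h2 := hw i
    simp only [Pi.vadd_apply, vadd_eq_add]
    linarith

/-- The retraction sends `x` to the supremum, computed in the lattice `C`, of the elements of `C`
below `x`. -/
theorem IsAmbitropicalCone.exists_isConeRetraction {C : Set (Fin n → ℝ)}
    (hC : IsAmbitropicalCone C) (hcl : IsClosed C) : ∃ R, IsConeRetraction R C := by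
  obtain ⟨e, he⟩ := hC.nonempty
  have key : ∀ x, ∃ z, IsLeast (C ∩ upperBounds {c | c ∈ C ∧ c ≤ x}) z := by
    intro x
    refine exists_isLeast_of_directedOn ?_ ?_ (hcl.inter ?_) ?_
    · exact ⟨dist x e +ᵥ e, hC.vadd_mem _ _ he, fun c hc => hc.2.trans (le_dist_vadd x e)⟩
    · refine ⟨-dist e x +ᵥ e, fun w hw => hw.2 ⟨hC.vadd_mem _ _ he, fun i => ?_⟩⟩
      have := le_dist_vadd e x i
      simp only [Pi.vadd_apply, vadd_eq_add] at this ⊢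
      linarith
    · have : upperBounds {c | c ∈ C ∧ c ≤ x} = ⋂ c ∈ {c | c ∈ C ∧ c ≤ x}, Set.Ici c := by
        ext w
        simp [mem_upperBounds]
      rw [this]
      exact isClosed_biInter fun c _ => isClosed_Ici
    · intro v hv w hw
      obtain ⟨z, hz, hz'⟩ := hC.exists_inf v hv.1 w hw.1
      exact ⟨z, ⟨hz.1, fun c hc => hz' ⟨hc.1, hv.2 hc, hw.2 hc⟩⟩, hz.2.1, hz.2.2⟩
  choose R hR using key
  refine ⟨R, fun x y hxy => ?_, isActionPreserving_of_le fun r x => ?_, fun x => (hR x).1.1,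
    fun x hx => ?_⟩
  · exact (hR x).2 ⟨(hR y).1.1, fun c hc => (hR y).1.2 ⟨hc.1, hc.2.trans hxy⟩⟩
  · refine (hR _).2 ⟨hC.vadd_mem _ _ (hR x).1.1, fun c hc i => ?_⟩
    have h1 : -r +ᵥ c ≤ x := fun i => by
      have := hc.2 i
      simp only [Pi.vadd_apply, vadd_eq_add] at this ⊢
      linarith
    have h2 := (hR x).1.2 ⟨hC.vadd_mem _ _ hc.1, h1⟩ i
    simp only [Pi.vadd_apply, vadd_eq_add] at h2 ⊢
    linarith
  · exact le_antisymm ((hR x).2 ⟨hx, fun c hc => hc.2⟩) ((hR x).1.2 ⟨hx, le_rfl⟩)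

end ConeRetraction

/-! ### The tropical projections -/

section Projections

variable {n : ℕ} {X : AdditiveCone n}

theorem exists_mem_le (hX : (X : Set (Fin n → ℝ)).Nonempty) (x : Fin n → ℝ) :
    ∃ e ∈ X, e ≤ x := by
  obtain ⟨e, he⟩ := hX
  refine ⟨-dist e x +ᵥ e, X.vadd_mem _ he, fun i => ?_⟩
  have := le_dist_vadd e x i
  simp only [Pi.vadd_apply, vadd_eq_add] at this ⊢
  linarith

theorem exists_le_mem (hX : (X : Set (Fin n → ℝ)).Nonempty) (x : Fin n → ℝ) :
    ∃ e ∈ X, x ≤ e := by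
  obtain ⟨e, he⟩ := hX
  exact ⟨dist x e +ᵥ e, X.vadd_mem _ he, le_dist_vadd x e⟩

theorem isLUB_projMax (hX : (X : Set (Fin n → ℝ)).Nonempty) (x : Fin n → ℝ) :
    IsLUB {e | e ∈ X ∧ e ≤ x} (projMax X x) := by
  have hsub : {e | e ∈ X ∧ e ≤ x} ⊆ {y | y ∈ maxSpan (X : Set (Fin n → ℝ)) ∧ y ≤ x} := by
    rintro e ⟨he, hex⟩
    exact ⟨⟨{e}, by simpa using he, Set.singleton_nonempty e, fun _ => 0, by simp⟩, hex⟩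
  have h : IsLUB {y | y ∈ maxSpan (X : Set (Fin n → ℝ)) ∧ y ≤ x} (projMax X x) := by
    refine isLUB_csSup ?_ ⟨x, fun y hy => hy.2⟩
    obtain ⟨e, he, hex⟩ := exists_mem_le hX x
    exact ⟨e, hsub ⟨he, hex⟩⟩
  refine ⟨fun e he => h.1 (hsub he), fun z hz => h.2 ?_⟩
  rintro y ⟨⟨S, hS, -, c, hc⟩, hyx⟩
  refine hc.2 ?_
  rintro _ ⟨f, hf, rfl⟩
  exact hz ⟨X.vadd_mem _ (hS hf), (hc.1 ⟨f, hf, rfl⟩).trans hyx⟩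

theorem isGLB_projMin (hX : (X : Set (Fin n → ℝ)).Nonempty) (x : Fin n → ℝ) :
    IsGLB {e | e ∈ X ∧ x ≤ e} (projMin X x) := by
  have hsub : {e | e ∈ X ∧ x ≤ e} ⊆ {y | y ∈ minSpan (X : Set (Fin n → ℝ)) ∧ x ≤ y} := by
    rintro e ⟨he, hex⟩
    exact ⟨⟨{e}, by simpa using he, Set.singleton_nonempty e, fun _ => 0, by simp⟩, hex⟩
  have h : IsGLB {y | y ∈ minSpan (X : Set (Fin n → ℝ)) ∧ x ≤ y} (projMin X x) := by
    refine isGLB_csInf ?_ ⟨x, fun y hy => hy.2⟩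
    obtain ⟨e, he, hex⟩ := exists_le_mem hX x
    exact ⟨e, hsub ⟨he, hex⟩⟩
  refine ⟨fun e he => h.1 (hsub he), fun z hz => h.2 ?_⟩
  rintro y ⟨⟨S, hS, -, c, hc⟩, hyx⟩
  refine hc.2 ?_
  rintro _ ⟨f, hf, rfl⟩
  exact hz ⟨X.vadd_mem _ (hS hf), hyx.trans (hc.1 ⟨f, hf, rfl⟩)⟩

variable (hX : (X : Set (Fin n → ℝ)).Nonempty)
include hX

theorem projMax_le (x : Fin n → ℝ) : projMax X x ≤ x := (isLUB_projMax hX x).2 fun _ he => he.2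

theorem le_projMin (x : Fin n → ℝ) : x ≤ projMin X x := (isGLB_projMin hX x).2 fun _ he => he.2

theorem projMax_le_of_forall {x z : Fin n → ℝ} (h : ∀ e ∈ X, e ≤ x → e ≤ z) :
    projMax X x ≤ z := (isLUB_projMax hX x).2 fun e he => h e he.1 he.2

theorem le_projMin_of_forall {x z : Fin n → ℝ} (h : ∀ e ∈ X, x ≤ e → z ≤ e) :
    z ≤ projMin X x := (isGLB_projMin hX x).2 fun e he => h e he.1 he.2

theorem projMax_mono : Monotone (projMax (X : Set (Fin n → ℝ))) := fun _ y hxy =>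
  projMax_le_of_forall hX fun _ he hex => (isLUB_projMax hX y).1 ⟨he, hex.trans hxy⟩

theorem projMin_mono : Monotone (projMin (X : Set (Fin n → ℝ))) := fun x _ hxy =>
  le_projMin_of_forall hX fun _ he hex => (isGLB_projMin hX x).1 ⟨he, hxy.trans hex⟩

theorem projMax_eq_self {x : Fin n → ℝ} (hx : x ∈ X) : projMax X x = x :=
  le_antisymm (projMax_le hX x) ((isLUB_projMax hX x).1 ⟨hx, le_rfl⟩)

theorem projMin_eq_self {x : Fin n → ℝ} (hx : x ∈ X) : projMin X x = x :=
  le_antisymm ((isGLB_projMin hX x).1 ⟨hx, le_rfl⟩) (le_projMin hX x)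

theorem projMax_idem (x : Fin n → ℝ) : projMax X (projMax X x) = projMax X x :=
  le_antisymm (projMax_le hX _) <| projMax_le_of_forall hX fun _ he hex =>
    (isLUB_projMax hX _).1 ⟨he, (isLUB_projMax hX x).1 ⟨he, hex⟩⟩

theorem projMin_idem (x : Fin n → ℝ) : projMin X (projMin X x) = projMin X x :=
  le_antisymm (le_projMin_of_forall hX fun _ he hex =>
    (isGLB_projMin hX _).1 ⟨he, (isGLB_projMin hX x).1 ⟨he, hex⟩⟩) (le_projMin hX _)

theorem projMax_vadd : IsActionPreserving (projMax (X : Set (Fin n → ℝ))) := by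
  refine isActionPreserving_of_le fun r x => projMax_le_of_forall hX fun e he hex i => ?_
  have h1 : -r +ᵥ e ≤ x := fun i => by
    have := hex i
    simp only [Pi.vadd_apply, vadd_eq_add] at this ⊢
    linarith
  have h2 := (isLUB_projMax hX x).1 ⟨X.vadd_mem _ he, h1⟩ i
  simp only [Pi.vadd_apply, vadd_eq_add] at h2 ⊢
  linarith

theorem projMin_vadd : IsActionPreserving (projMin (X : Set (Fin n → ℝ))) := by
  refine isActionPreserving_of_le fun r x i => ?_
  have h : -r +ᵥ projMin X (r +ᵥ x) ≤ projMin X x := by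
    refine le_projMin_of_forall hX fun e he hxe i => ?_
    have h1 : r +ᵥ x ≤ r +ᵥ e := fun i => by
      have := hxe i
      simp only [Pi.vadd_apply, vadd_eq_add]
      linarith
    have h2 := (isGLB_projMin hX (r +ᵥ x)).1 ⟨X.vadd_mem _ he, h1⟩ i
    simp only [Pi.vadd_apply, vadd_eq_add] at h2 ⊢
    linarith
  have h3 := h i
  simp only [Pi.vadd_apply, vadd_eq_add] at h3 ⊢
  linarith

theorem isConeRetraction_projMax_projMin :
    IsConeRetraction (projMax (X : Set (Fin n → ℝ)) ∘ projMin X)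
      (Set.range (projMax (X : Set (Fin n → ℝ)) ∘ projMin X)) := by
  refine .of_idem ((projMax_mono hX).comp (projMin_mono hX))
    (fun r x => by simp only [Function.comp, projMin_vadd hX r x, projMax_vadd hX r])
    fun x => le_antisymm (projMax_mono hX ?_) ?_
  · calc projMin X (projMax X (projMin X x)) ≤ projMin X (projMin X x) :=
          projMin_mono hX (projMax_le hX _)
      _ = projMin X x := projMin_idem hX x
  · calc projMax X (projMin X x) = projMax X (projMax X (projMin X x)) :=
          (projMax_idem hX _).symm
      _ ≤ _ := projMax_mono hX (le_projMin hX _)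

theorem isConeRetraction_projMin_projMax :
    IsConeRetraction (projMin (X : Set (Fin n → ℝ)) ∘ projMax X)
      (Set.range (projMin (X : Set (Fin n → ℝ)) ∘ projMax X)) := by
  refine .of_idem ((projMin_mono hX).comp (projMax_mono hX))
    (fun r x => by simp only [Function.comp, projMax_vadd hX r x, projMin_vadd hX r])
    fun x => le_antisymm ?_ (projMin_mono hX ?_)
  · calc _ ≤ projMin X (projMin X (projMax X x)) := projMin_mono hX (projMax_le hX _)
      _ = projMin X (projMax X x) := projMin_idem hX _
  · calc projMax X x = projMax X (projMax X x) := (projMax_idem hX x).symm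
      _ ≤ projMax X (projMin X (projMax X x)) := projMax_mono hX (le_projMin hX _)

theorem subset_range_projMax_projMin :
    (X : Set (Fin n → ℝ)) ⊆ Set.range (projMax (X : Set (Fin n → ℝ)) ∘ projMin X) :=
  fun x hx => ⟨x, by rw [Function.comp, projMin_eq_self hX hx, projMax_eq_self hX hx]⟩

theorem subset_range_projMin_projMax :
    (X : Set (Fin n → ℝ)) ⊆ Set.range (projMin (X : Set (Fin n → ℝ)) ∘ projMax X) :=
  fun x hx => ⟨x, by rw [Function.comp, projMax_eq_self hX hx, projMin_eq_self hX hx]⟩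

/-- Order rigidity, up to an error `D` which is `0` in the order-theoretic applications: the first
conclusion holds because `P y = y`, the second follows by applying `P ∘ Q` to `z ≤ D + Q y`. -/
theorem le_vadd_and_le_vadd_of_mem_range {y z : Fin n → ℝ} {D : ℝ}
    (hy : y ∈ Set.range (projMax (X : Set (Fin n → ℝ)) ∘ projMin X))
    (hz : z ∈ Set.range (projMax (X : Set (Fin n → ℝ)) ∘ projMin X))
    (h1 : projMax X y ≤ D +ᵥ z) (h2 : z ≤ D +ᵥ projMin X y) :
    y ≤ D +ᵥ z ∧ z ≤ D +ᵥ y := by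
  have hR := isConeRetraction_projMax_projMin hX
  have hPy : projMax X y = y := by
    obtain ⟨x, rfl⟩ := hy
    exact projMax_idem hX _
  refine ⟨hPy ▸ h1, ?_⟩
  have h3 := hR.monotone h2
  rwa [hR.map_eq z hz, hR.map_vadd, Function.comp_apply, projMin_idem hX,
    ← Function.comp_apply (f := projMax _), hR.map_eq y hy] at h3

theorem projMax_le_map_le_projMin {F : (Fin n → ℝ) → (Fin n → ℝ)} (hF : Monotone F)
    (hFX : ∀ x ∈ X, F x = x) (y : Fin n → ℝ) : projMax X y ≤ F y ∧ F y ≤ projMin X y :=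
  ⟨projMax_le_of_forall hX fun e he hey => hFX e he ▸ hF hey,
    le_projMin_of_forall hX fun e he hye => hFX e he ▸ hF hye⟩

theorem map_eq_of_mem_range_projMax_projMin {F : (Fin n → ℝ) → (Fin n → ℝ)} (hF : Monotone F)
    (hFX : ∀ x ∈ X, F x = x) {y : Fin n → ℝ}
    (hy : y ∈ Set.range (projMax (X : Set (Fin n → ℝ)) ∘ projMin X))
    (hFy : F y ∈ Set.range (projMax (X : Set (Fin n → ℝ)) ∘ projMin X)) : F y = y := by
  have h := projMax_le_map_le_projMin hX hF hFX y
  have := le_vadd_and_le_vadd_of_mem_range hX (D := 0) hy hFy (by simpa using h.1)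
    (by simpa using h.2)
  exact le_antisymm (by simpa using this.2) (by simpa using this.1)

theorem map_eq_of_mem_range_projMin_projMax {F : (Fin n → ℝ) → (Fin n → ℝ)} (hF : Monotone F)
    (hFX : ∀ x ∈ X, F x = x) {y : Fin n → ℝ}
    (hy : y ∈ Set.range (projMin (X : Set (Fin n → ℝ)) ∘ projMax X))
    (hFy : F y ∈ Set.range (projMin (X : Set (Fin n → ℝ)) ∘ projMax X)) : F y = y := by
  have hR := isConeRetraction_projMin_projMax hX
  have h := projMax_le_map_le_projMin hX hF hFX y
  have hQy : projMin X y = y := by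
    obtain ⟨x, rfl⟩ := hy
    exact projMin_idem hX _
  refine le_antisymm (h.2.trans_eq hQy) ?_
  have h3 := hR.monotone h.1
  rwa [hR.map_eq _ hFy, Function.comp_apply, projMax_idem hX,
    ← Function.comp_apply (f := projMin _), hR.map_eq y hy] at h3

omit hX in
/-- A closed ambitropical cone containing `X` is an ambitropical hull as soon as it is rigid for
monotone self-maps fixing `X`. -/
theorem IsConeRetraction.isAmbitropicalHull {R : (Fin n → ℝ) → (Fin n → ℝ)}
    {B : Set (Fin n → ℝ)} (hR : IsConeRetraction R B) (hXB : (X : Set (Fin n → ℝ)) ⊆ B)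
    (h : ∀ F : (Fin n → ℝ) → (Fin n → ℝ), Monotone F → (∀ x ∈ X, F x = x) →
      ∀ y ∈ B, F y ∈ B → F y = y) : IsAmbitropicalHull (X : Set (Fin n → ℝ)) B := by
  refine ⟨⟨hR.isAmbitropicalCone, hR.isClosed, hXB⟩, ?_⟩
  rintro C ⟨hC, hCc, hXC⟩ hCB y hy
  obtain ⟨S, hS⟩ := hC.exists_isConeRetraction hCc
  rw [← h S hS.monotone (fun x hx => hS.map_eq x (hXC hx)) y hy (hCB (hS.mem y))]
  exact hS.mem y

theorem isAmbitropicalHull_range_projMax_projMin : IsAmbitropicalHull (X : Set (Fin n → ℝ))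
    (Set.range (projMax (X : Set (Fin n → ℝ)) ∘ projMin X)) :=
  (isConeRetraction_projMax_projMin hX).isAmbitropicalHull (subset_range_projMax_projMin hX)
    fun _ hF hFX _ hy hFy => map_eq_of_mem_range_projMax_projMin hX hF hFX hy hFy

theorem isAmbitropicalHull_range_projMin_projMax : IsAmbitropicalHull (X : Set (Fin n → ℝ))
    (Set.range (projMin (X : Set (Fin n → ℝ)) ∘ projMax X)) :=
  (isConeRetraction_projMin_projMax hX).isAmbitropicalHull (subset_range_projMin_projMax hX)
    fun _ hF hFX _ hy hFy => map_eq_of_mem_range_projMin_projMax hX hF hFX hy hFy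

/-- Metric rigidity: the range of `P ∘ Q` embeds isometrically in the functions on `X`. -/
theorem dist_le_of_forall_dist_le {y z : Fin n → ℝ} {D : ℝ} (hD : 0 ≤ D)
    (hy : y ∈ Set.range (projMax (X : Set (Fin n → ℝ)) ∘ projMin X))
    (hz : z ∈ Set.range (projMax (X : Set (Fin n → ℝ)) ∘ projMin X))
    (h : ∀ x ∈ X, dist z x ≤ dist y x + D) : dist y z ≤ D := by
  have h1 : projMax X y ≤ D +ᵥ z := by
    refine projMax_le_of_forall hX fun e he hey i => ?_
    -- Since `e ≤ y`, the translate of `e` by `dist y e` is at distance at most `dist y e` from `y`.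
    -- Read in the coordinate `i`, the hypothesis `h` at this translate gives `e i - z i ≤ D`.
    have h1 := h _ (X.vadd_mem (dist y e) he)
    have h2 : dist y (dist y e +ᵥ e) ≤ dist y e := by
      refine (dist_pi_le_iff dist_nonneg).2 fun j => ?_
      have h3 := le_dist_vadd y e j
      have h4 := hey j
      simp only [Pi.vadd_apply, vadd_eq_add, Real.dist_eq] at h3 ⊢
      rw [abs_le]
      constructor <;> linarith
    have h5 := le_dist_vadd (dist y e +ᵥ e) z i
    rw [dist_comm _ z] at h5
    simp only [Pi.vadd_apply, vadd_eq_add] at h5 ⊢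
    linarith
  have h2 : z ≤ D +ᵥ projMin X y := by
    have : -D +ᵥ z ≤ projMin X y := by
      refine le_projMin_of_forall hX fun e he hye i => ?_
      have h1 := h _ (X.vadd_mem (-dist e y) he)
      have h2 : dist y (-dist e y +ᵥ e) ≤ dist e y := by
        refine (dist_pi_le_iff dist_nonneg).2 fun j => ?_
        have h3 := le_dist_vadd e y j
        have h4 := hye j
        simp only [Pi.vadd_apply, vadd_eq_add, Real.dist_eq] at h3 ⊢
        rw [abs_le]
        constructor <;> linarith
      have h5 := le_dist_vadd z (-dist e y +ᵥ e) i
      simp only [Pi.vadd_apply, vadd_eq_add] at h5 ⊢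
      linarith
    intro i
    have h3 := this i
    simp only [Pi.vadd_apply, vadd_eq_add] at h3 ⊢
    linarith
  have h3 := le_vadd_and_le_vadd_of_mem_range hX hy hz h1 h2
  exact dist_le_of_le_vadd hD h3.1 h3.2

end Projections

/-! ### The tight span as an ambitropical hull -/

namespace TightSpan

theorem dist_embed {X : Type*} [MetricSpace X] (f : TightSpan X) (x : X) :
    dist f (embed x) = f x := by
  refine le_antisymm (Real.iSup_le (fun z => ?_) (f.nonneg x)) ?_
  · have h1 := f.dist_le x z
    have h2 := f.le_add_dist z x
    rw [dist_comm z x] at h2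
    have h3 : (embed x : TightSpan X) z = dist x z := rfl
    rw [h3, abs_le]
    constructor <;> linarith
  · have h1 : |f x - (embed x : TightSpan X) x| ≤ dist f (embed x) :=
      le_ciSup (bddAbove_abs_sub f (embed x)) x
    have h3 : (embed x : TightSpan X) x = dist x x := rfl
    rw [h3, dist_self, sub_zero] at h1
    exact (le_abs_self _).trans h1

theorem isometry_embed {X : Type*} [MetricSpace X] : Isometry (embed : X → TightSpan X) :=
  Isometry.of_dist_eq fun x y => dist_embed (embed x) y

theorem embed_vadd {X : Type*} [MetricSpace X] [AddAction ℝ X] [IsRealActionSpace X] :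
    IsActionPreserving (embed : X → TightSpan X) := fun r x => by
  refine DFunLike.ext _ _ fun y => ?_
  change dist (r +ᵥ x) y = dist x (-r +ᵥ y)
  rw [← IsRealActionSpace.dist_vadd (-r), neg_vadd_vadd]

/-- Rigidity of the tight span: `F f` is dominated by `f`, hence equal to it by minimality. -/
theorem map_eq_of_lipschitz {X : Type*} [MetricSpace X] {F : TightSpan X → TightSpan X}
    (hF : LipschitzWith 1 F) (he : ∀ x, F (embed x) = embed x) (f : TightSpan X) : F f = f := by
  have h : ∀ x, F f x ≤ f x := fun x => by
    rw [← dist_embed, ← dist_embed f]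
    simpa [he] using hF.dist_le_mul f (embed x)
  exact DFunLike.ext _ _ fun x => le_antisymm (h x) (f.2.2 (F f).2.1 h x)

end TightSpan

section Realization

variable {n : ℕ} {X : AdditiveCone n}

/-- The balls with centres `x` and radii `f x` have a common point in `ℝⁿ`; the nonexpansive
retraction moves it to `B`. -/
theorem IsConeRetraction.exists_forall_dist_le {R : (Fin n → ℝ) → (Fin n → ℝ)}
    {B : Set (Fin n → ℝ)} (hR : IsConeRetraction R B) (hX : (X : Set (Fin n → ℝ)).Nonempty)
    (hXB : (X : Set (Fin n → ℝ)) ⊆ B)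
    {f : X → ℝ} (hf : ∀ x y, dist x y ≤ f x + f y) : ∃ y ∈ B, ∀ x : X, dist y x ≤ f x := by
  have : Nonempty X := hX.to_subtype
  have hf' : ∀ (x y : X) i, x.1 i - f x ≤ y.1 i + f y := fun x y i => by
    have h1 := hf x y
    have h2 := le_dist_vadd x.1 y.1 i
    rw [Subtype.dist_eq] at h1
    simp only [Pi.vadd_apply, vadd_eq_add] at h2
    linarith
  have hb : ∀ i, BddBelow (Set.range fun x : X => x.1 i + f x) := fun i => by
    obtain ⟨o⟩ := (inferInstance : Nonempty X)
    refine ⟨o.1 i - f o, ?_⟩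
    rintro _ ⟨x, rfl⟩
    exact hf' o x i
  refine ⟨R fun i => ⨅ x : X, (x.1 i + f x), hR.mem _, fun x => ?_⟩
  have h0 : 0 ≤ f x := by
    have := hf x x
    rw [dist_self] at this
    linarith
  calc dist (R fun i => ⨅ x : X, (x.1 i + f x)) x
      = dist (R fun i => ⨅ x : X, (x.1 i + f x)) (R x) := by rw [hR.map_eq x (hXB x.2)]
    _ ≤ dist (fun i => ⨅ x : X, (x.1 i + f x)) x.1 := hR.dist_le _ _
    _ ≤ f x := by
      refine (dist_pi_le_iff h0).2 fun i => ?_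
      have h1 := ciInf_le (hb i) x
      have h2 : x.1 i - f x ≤ ⨅ x : X, (x.1 i + f x) := le_ciInf fun y => hf' x y i
      rw [Real.dist_eq, abs_le]
      constructor <;> linarith

theorem exists_tightSpan_map_range_projMax_projMin [NeZero n]
    (hX : (X : Set (Fin n → ℝ)).Nonempty) :
    ∃ φ : TightSpan X → (Fin n → ℝ), Isometry φ ∧ IsActionPreserving φ ∧
      (∀ x : X, φ (TightSpan.embed x) = x) ∧
      Set.range φ = Set.range (projMax (X : Set (Fin n → ℝ)) ∘ projMin X) := by
  have hR := isConeRetraction_projMax_projMin hX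
  have hXB := subset_range_projMax_projMin hX
  -- Points of the range of `P ∘ Q` are determined by their distances to the points of `X`.
  have huniq : ∀ {y z}, y ∈ Set.range (projMax (X : Set (Fin n → ℝ)) ∘ projMin X) →
      z ∈ Set.range (projMax (X : Set (Fin n → ℝ)) ∘ projMin X) →
      (∀ x : X, dist z x ≤ dist y x) → y = z := fun hy hz h =>
    dist_le_zero.1 (dist_le_of_forall_dist_le hX le_rfl hy hz fun x hx => by
      simpa using h ⟨x, hx⟩)
  have hcon : ∀ (y : Fin n → ℝ) (a b : X), dist a b ≤ dist y a + dist y b := fun y a b =>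
    dist_triangle_left a.1 b.1 y
  have key : ∀ f : TightSpan X,
      ∃ y ∈ Set.range (projMax (X : Set (Fin n → ℝ)) ∘ projMin X), ∀ x : X, dist y x = f x := by
    intro f
    obtain ⟨y, hy, hyf⟩ := hR.exists_forall_dist_le hX hXB f.dist_le
    exact ⟨y, hy, fun x => le_antisymm (hyf x) (f.2.2 (hcon y) hyf x)⟩
  choose φ hφ hφd using key
  refine ⟨φ, Isometry.of_dist_eq fun f g => le_antisymm ?_ ?_, fun r f => ?_, fun x => ?_,
    Set.Subset.antisymm (Set.range_subset_iff.2 hφ) fun y hy => ?_⟩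
  · refine dist_le_of_forall_dist_le hX dist_nonneg (hφ f) (hφ g) fun x hx => ?_
    have h1 : |f ⟨x, hx⟩ - g ⟨x, hx⟩| ≤ dist f g :=
      le_ciSup (TightSpan.bddAbove_abs_sub f g) ⟨x, hx⟩
    have h2 := hφd f ⟨x, hx⟩
    have h3 := hφd g ⟨x, hx⟩
    have h4 := neg_abs_le (f ⟨x, hx⟩ - g ⟨x, hx⟩)
    linarith
  · refine Real.iSup_le (fun x => ?_) dist_nonneg
    rw [← hφd f, ← hφd g]
    exact abs_dist_sub_le _ _ _
  · refine huniq (hφ _) ?_ fun x => le_of_eq ?_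
    · rw [← hR.map_eq _ (hφ f), ← hR.map_vadd]
      exact hR.mem _
    · rw [hφd, dist_vadd_left_eq]
      exact hφd f (-r +ᵥ x)
  · exact huniq (hφ _) (hXB x.2) fun z => (hφd (TightSpan.embed x) z).ge
  · have hmin : Minimal (fun g : X → ℝ => ∀ x y, dist x y ≤ g x + g y) fun x => dist y x := by
      refine ⟨hcon y, fun g hg hgy => ?_⟩
      obtain ⟨z, hz, hzg⟩ := hR.exists_forall_dist_le hX hXB hg
      have hyz : y = z := huniq hy hz fun x => (hzg x).trans (hgy x)
      exact hyz ▸ hzg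
    exact ⟨⟨_, hmin⟩, (huniq hy (hφ _) fun x => (hφd ⟨_, hmin⟩ x).le).symm⟩

/-- A hull `A` with retraction `S` is `S (B)`, for `B` the range of `R = P ∘ Q`: the map `R ∘ S`
is the identity on `B` by rigidity, so that `S` is isometric on `B` and `S ∘ R` is a retraction on
`S (B) ⊆ A`. -/
theorem exists_tightSpan_map [NeZero n] (hX : (X : Set (Fin n → ℝ)).Nonempty)
    {A : Set (Fin n → ℝ)} (hA : IsAmbitropicalHull (X : Set (Fin n → ℝ)) A) :
    ∃ φ : TightSpan X → (Fin n → ℝ), Isometry φ ∧ IsActionPreserving φ ∧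
      (∀ x : X, φ (TightSpan.embed x) = x) ∧ Set.range φ = A := by
  obtain ⟨φ, hφi, hφv, hφX, hφr⟩ := exists_tightSpan_map_range_projMax_projMin hX
  obtain ⟨⟨hAc, hAcl, hXA⟩, hmin⟩ := hA
  obtain ⟨S, hS⟩ := hAc.exists_isConeRetraction hAcl
  have hR := isConeRetraction_projMax_projMin hX
  have hXB := subset_range_projMax_projMin hX
  set R := projMax (X : Set (Fin n → ℝ)) ∘ projMin X
  have hRS : ∀ y ∈ Set.range R, R (S y) = y := fun y hy =>
    map_eq_of_mem_range_projMax_projMin hX (F := R ∘ S) (hR.monotone.comp hS.monotone)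
      (fun x hx => by rw [Function.comp_apply, hS.map_eq x (hXA hx), hR.map_eq x (hXB hx)]) hy
      (hR.mem _)
  have hSX : ∀ x ∈ X, S x = x := fun x hx => hS.map_eq x (hXA hx)
  have hSR : IsConeRetraction (S ∘ R) (Set.range (S ∘ R)) :=
    .of_idem (hS.monotone.comp hR.monotone)
      (fun r x => by simp only [Function.comp_apply, hR.map_vadd r x, hS.map_vadd r])
      fun x => by simp only [Function.comp_apply, hRS _ (hR.mem x)]
  have hle : Set.range (S ∘ R) ⊆ A := Set.range_subset_iff.2 fun x => hS.mem _
  have hmem : ∀ f, φ f ∈ Set.range R := fun f => hφr ▸ Set.mem_range_self f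
  refine ⟨S ∘ φ, Isometry.of_dist_eq fun f g => le_antisymm ?_ ?_, fun r f => ?_, fun x => ?_, ?_⟩
  · exact (hS.dist_le _ _).trans_eq (hφi.dist_eq f g)
  · rw [← hφi.dist_eq, ← hRS _ (hmem f), ← hRS _ (hmem g)]
    exact hR.dist_le _ _
  · simp only [Function.comp_apply, hφv r f, hS.map_vadd r]
  · rw [Function.comp_apply, hφX, hSX x x.2]
  · rw [Set.range_comp, hφr, ← Set.range_comp]
    refine hle.antisymm (hmin ⟨hSR.isAmbitropicalCone, hSR.isClosed, fun x hx => ⟨x, ?_⟩⟩ hle)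
    rw [Function.comp_apply, hR.map_eq x (hXB hx), hSX x hx]

end Realization

/-! ### Injectivity -/

/-- McShane extension to `ℝⁿ`, for a nonexpansive map given by an equivariant family of pairs
`(s a, v a)` of a point and its image. -/
theorem exists_equivariant_extension {n : ℕ} {Y ι : Type*} [MetricSpace Y] [AddAction ℝ Y]
    [IsRealActionSpace Y] [AddAction ℝ ι] [Nonempty ι] {s : ι → Y} {v : ι → Fin n → ℝ}
    (hs : IsActionPreserving s) (hv : IsActionPreserving v)
    (h : ∀ a b, dist (v a) (v b) ≤ dist (s a) (s b)) :
    ∃ g : Y → Fin n → ℝ, LipschitzWith 1 g ∧ IsActionPreserving g ∧ ∀ a, g (s a) = v a := by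
  have h' : ∀ a b i, v a i ≤ v b i + dist (s a) (s b) := fun a b i => by
    have h1 := le_dist_vadd (v a) (v b) i
    have h2 := h a b
    simp only [Pi.vadd_apply, vadd_eq_add] at h1
    linarith
  have hb : ∀ y i, BddBelow (Set.range fun a => v a i + dist y (s a)) := fun y i => by
    obtain ⟨o⟩ := (inferInstance : Nonempty ι)
    refine ⟨v o i - dist y (s o), ?_⟩
    rintro _ ⟨a, rfl⟩
    have h1 := h' o a i
    have h2 := dist_triangle_left (s o) (s a) y
    change v o i - dist y (s o) ≤ v a i + dist y (s a)
    linarith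
  let g : Y → Fin n → ℝ := fun y i => ⨅ a, (v a i + dist y (s a))
  have hg : ∀ y z, g y ≤ dist y z +ᵥ g z := fun y z i => by
    rw [Pi.vadd_apply, vadd_eq_add, ← sub_le_iff_le_add']
    refine le_ciInf fun a => ?_
    have h1 : g y i ≤ v a i + dist y (s a) := ciInf_le (hb y i) a
    have h2 := dist_triangle y z (s a)
    linarith
  have hle : ∀ (r : ℝ) y i, g (r +ᵥ y) i ≤ r + g y i := fun r y i => by
    rw [← sub_le_iff_le_add']
    refine le_ciInf fun a => ?_
    have h1 : g (r +ᵥ y) i ≤ v (r +ᵥ a) i + dist (r +ᵥ y) (s (r +ᵥ a)) := ciInf_le (hb _ i) _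
    rw [hs, hv, IsRealActionSpace.dist_vadd, Pi.vadd_apply, vadd_eq_add] at h1
    linarith
  refine ⟨g, .of_dist_le_mul fun y z => ?_, fun r y => ?_, fun a => ?_⟩
  · rw [NNReal.coe_one, one_mul]
    exact dist_le_of_le_vadd dist_nonneg (hg y z) (dist_comm y z ▸ hg z y)
  · refine funext fun i => le_antisymm (hle r y i) ?_
    have h1 := hle (-r) (r +ᵥ y) i
    rw [neg_vadd_vadd] at h1
    rw [Pi.vadd_apply, vadd_eq_add]
    linarith
  · refine funext fun i => le_antisymm ?_ (le_ciInf fun b => h' a b i)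
    simpa using ciInf_le (hb (s a) i) a

/-- `C` is injective if it is isometric, as a space with a real action, to a retract of `ℝⁿ`. -/
theorem IsConeRetraction.isInjectiveActionSpace {n : ℕ} {R : (Fin n → ℝ) → (Fin n → ℝ)}
    {A : Set (Fin n → ℝ)} (hR : IsConeRetraction R A) {C : Type u} [MetricSpace C] [AddAction ℝ C]
    {σ : C → Fin n → ℝ} (hσ : Isometry σ) (hσv : IsActionPreserving σ) (hσr : Set.range σ = A) :
    IsInjectiveActionSpace.{v, u} C := by
  intro Y _ _ _ S f hf hfv
  obtain ⟨G, hG, hGv, hGS⟩ : ∃ G : Y → Fin n → ℝ, LipschitzWith 1 G ∧ IsActionPreserving G ∧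
      ∀ s : S, G s = σ (f s) := by
    rcases isEmpty_or_nonempty S with hS | hS
    · rcases isEmpty_or_nonempty Y with hY | ⟨⟨o⟩⟩
      · exact ⟨fun y => hY.elim y, fun y => hY.elim y, fun _ y => hY.elim y, fun s => hS.elim s⟩
      -- With nothing to extend, a map to `ℝⁿ` is still needed: extend one defined on an orbit.
      · obtain ⟨G, hG, hGv, -⟩ := exists_equivariant_extension (n := n) (ι := ℝ)
          (s := fun r => r +ᵥ o) (v := fun r _ => r) (fun r a => add_vadd r a o)
          (fun r a => rfl) fun a b => by
            rw [IsRealActionSpace.dist_vadd_vadd_same]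
            exact (dist_pi_le_iff (abs_nonneg _)).2 fun i => le_of_eq (Real.dist_eq a b)
        exact ⟨G, hG, hGv, fun s => hS.elim s⟩
    · exact exists_equivariant_extension (s := ((↑) : S → Y)) (v := σ ∘ f) (fun _ _ => rfl)
        (fun r a => by simp only [Function.comp_apply, hfv r a, hσv r])
        fun a b => by
          simpa [hσ.dist_eq, Subtype.dist_eq] using hf.dist_le_mul a b
  have key : ∀ y, ∃ c, σ c = R (G y) := fun y => by
    have := hR.mem (G y)
    rwa [← hσr] at this
  choose g hg using key
  refine ⟨g, .of_dist_le_mul fun y z => ?_, fun r y => hσ.injective ?_,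
    fun s => hσ.injective ?_⟩
  · rw [← hσ.dist_eq, hg, hg]
    exact (hR.dist_le _ _).trans (hG.dist_le_mul y z)
  · rw [hg, hσv, hg, hGv, hR.map_vadd]
  · rw [hg, hGS, hR.map_eq]
    exact hσr ▸ Set.mem_range_self _

theorem isRealActionSpace_of_isometry {E F : Type*} [MetricSpace E] [AddAction ℝ E]
    [MetricSpace F] [AddAction ℝ F] [IsRealActionSpace F] {σ : E → F} (hσ : Isometry σ)
    (hσv : IsActionPreserving σ) : IsRealActionSpace E where
  dist_vadd_vadd_same r s x := by
    rw [← hσ.dist_eq, hσv, hσv, IsRealActionSpace.dist_vadd_vadd_same]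
  dist_vadd r x y := by rw [← hσ.dist_eq, hσv, hσv, IsRealActionSpace.dist_vadd, hσ.dist_eq]

instance {n : ℕ} [NeZero n] : IsRealActionSpace (Fin n → ℝ) :=
  isRealActionSpace_of_isometry (F := (⊤ : AdditiveCone n)) (σ := fun x => ⟨x, trivial⟩)
    (fun _ _ => rfl) fun _ _ => rfl

/-- The action on a lift to a higher universe, needed because the universe of the test spaces in
the definition of injectivity is arbitrary. -/
instance ULift.realAddAction {E : Type u} [AddAction ℝ E] : AddAction ℝ (ULift.{v} E) where
  vadd r x := ⟨r +ᵥ x.down⟩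
  zero_vadd x := congrArg ULift.up (zero_vadd ℝ x.down)
  add_vadd r s x := congrArg ULift.up (add_vadd r s x.down)

theorem ULift.isometry_down {E : Type u} [MetricSpace E] :
    Isometry (ULift.down : ULift.{v} E → E) := fun _ _ => rfl

theorem ULift.isRealActionSpace {E : Type u} [MetricSpace E] [AddAction ℝ E]
    [IsRealActionSpace E] : IsRealActionSpace (ULift.{v} E) :=
  isRealActionSpace_of_isometry ULift.isometry_down fun _ _ => rfl

/-- A nonexpansive map to an injective space extends along an isometric embedding `i : X → Z`. -/
theorem IsInjectiveActionSpace.exists_extension {C : Type u} [MetricSpace C] [AddAction ℝ C]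
    (hC : IsInjectiveActionSpace.{v, u} C) {X : Type w} [MetricSpace X] [AddAction ℝ X]
    {Z : Type v} [MetricSpace Z] [AddAction ℝ Z] [IsRealActionSpace Z] {i : X → Z}
    (hi : Isometry i) (hiv : IsActionPreserving i) {f : X → C} (hf : LipschitzWith 1 f)
    (hfv : IsActionPreserving f) :
    ∃ g : Z → C, LipschitzWith 1 g ∧ IsActionPreserving g ∧ ∀ x, g (i x) = f x := by
  let S : SubAddAction ℝ Z :=
    { carrier := Set.range i
      vadd_mem' := by
        rintro r _ ⟨x, rfl⟩
        exact ⟨r +ᵥ x, hiv r x⟩ }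
  choose p hp using fun s : S => (s.2 : (s : Z) ∈ Set.range i)
  have hpd : ∀ s t, dist (p s) (p t) = dist s t := fun s t => by
    rw [← hi.dist_eq, hp, hp, Subtype.dist_eq]
  obtain ⟨g, hg, hgv, hgS⟩ := hC Z S (f ∘ p)
    (.of_dist_le_mul fun s t => by
      rw [← hpd]
      exact hf.dist_le_mul _ _)
    fun r s => by
      have : p (r +ᵥ s) = r +ᵥ p s := hi.injective (by rw [hp, hiv, hp]; rfl)
      rw [Function.comp_apply, this, hfv, Function.comp_apply]
  refine ⟨g, hg, hgv, fun x => ?_⟩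
  have h1 := hgS ⟨i x, x, rfl⟩
  have h2 : p ⟨i x, x, rfl⟩ = x := hi.injective (hp _)
  rw [Function.comp_apply, h2] at h1
  exact h1

/-- A nonexpansive map to an injective space extends to the tight span, in whatever universe the
test spaces of injectivity are. -/
theorem IsInjectiveActionSpace.exists_extension_tightSpan {C : Type u} [MetricSpace C]
    [AddAction ℝ C] (hC : IsInjectiveActionSpace.{v, u} C) {X : Type} [MetricSpace X]
    [AddAction ℝ X] [IsRealActionSpace X] [IsRealActionSpace (TightSpan X)] {f : X → C}
    (hf : LipschitzWith 1 f) (hfv : IsActionPreserving f) :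
    ∃ g : TightSpan X → C, LipschitzWith 1 g ∧ IsActionPreserving g ∧
      ∀ x, g (TightSpan.embed x) = f x := by
  have := ULift.isRealActionSpace.{v, 0} (E := TightSpan X)
  obtain ⟨g, hg, hgv, hgX⟩ := hC.exists_extension
    (Z := ULift.{v} (TightSpan X)) (i := fun x => ⟨TightSpan.embed x⟩)
    (fun x y => TightSpan.isometry_embed x y)
    (fun r x => congrArg ULift.up (TightSpan.embed_vadd r x)) hf hfv
  exact ⟨fun t => g ⟨t⟩, fun s t => hg ⟨s⟩ ⟨t⟩, fun r t => hgv r ⟨t⟩, hgX⟩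

/-- An injective tight span is an injective hull: the extensions `T(X) → Y → T(X)` compose to the
identity by rigidity, so that the first one is isometric. -/
theorem TightSpan.isInjectiveHull {X : Type} [MetricSpace X] [AddAction ℝ X] [IsRealActionSpace X]
    [hT : IsRealActionSpace (TightSpan X)] (hinj : IsInjectiveActionSpace.{v, 0} (TightSpan X)) :
    IsInjectiveHull.{v, 0, 0} (embed : X → TightSpan X) where
  isRealActionSpace := hT
  isInjective := hinj
  isometry := isometry_embed
  isActionPreserving := embed_vadd
  exists_factor Y _ _ _ hY i hi hiv := by
    obtain ⟨φ, hφ, hφv, hφX⟩ := hY.exists_extension_tightSpan hi.lipschitz hiv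
    obtain ⟨ψ, hψ, -, hψX⟩ := hinj.exists_extension hi hiv isometry_embed.lipschitz embed_vadd
    have hid : ∀ f, ψ (φ f) = f := map_eq_of_lipschitz (F := ψ ∘ φ)
      (by simpa using hψ.comp hφ) fun x => by rw [Function.comp_apply, hφX, hψX]
    refine ⟨φ, Isometry.of_dist_eq fun f g => le_antisymm ?_ ?_, hφv, funext fun x => (hφX x).symm⟩
    · simpa using hφ.dist_le_mul f g
    · simpa [hid] using hψ.dist_le_mul (φ f) (φ g)

theorem Isometry.exists_isometryEquiv_of_range_eq {n : ℕ} {H : Type*} [MetricSpace H]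
    {φ : H → Fin n → ℝ} (hφ : Isometry φ) {A : Set (Fin n → ℝ)} (hA : Set.range φ = A) :
    ∃ e : H ≃ᵢ A, ∀ h, (e h : Fin n → ℝ) = φ h := by
  subst hA
  exact ⟨hφ.isometryEquivOnRange, fun _ => rfl⟩

/-- The embedding `φ : H → A` given by the universal property of `H` is surjective, because
`T(X) → H → A ≃ T(X)` is the identity by rigidity. -/
theorem IsInjectiveHull.exists_map {n : ℕ} [NeZero n] {X : AdditiveCone n}
    (hX : (X : Set (Fin n → ℝ)).Nonempty) {A : Set (Fin n → ℝ)}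
    (hA : IsAmbitropicalHull (X : Set (Fin n → ℝ)) A) {H : Type u} [MetricSpace H] [AddAction ℝ H]
    {j : X → H} (hj : IsInjectiveHull.{v, u, 0} j) :
    ∃ φ : H → (Fin n → ℝ), Isometry φ ∧ IsActionPreserving φ ∧ (∀ x : X, φ (j x) = x) ∧
      Set.range φ = A := by
  obtain ⟨τ, hτ, hτv, hτX, hτr⟩ := exists_tightSpan_map hX hA
  obtain ⟨⟨hAc, hAcl, hXA⟩, -⟩ := hA
  obtain ⟨S, hS⟩ := hAc.exists_isConeRetraction hAcl
  let A' : AdditiveCone n := ⟨A, fun r x hx => hAc.vadd_mem r x hx⟩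
  have := ULift.isRealActionSpace.{v, 0} (E := A')
  have : IsRealActionSpace (TightSpan X) := isRealActionSpace_of_isometry hτ hτv
  have hinj : IsInjectiveActionSpace.{v, v} (ULift.{v} A') :=
    hS.isInjectiveActionSpace (σ := fun a => a.down.1) (fun _ _ => rfl) (fun _ _ => rfl)
      (Set.ext fun a => ⟨by rintro ⟨b, rfl⟩; exact b.down.2, fun ha => ⟨⟨⟨a, ha⟩⟩, rfl⟩⟩)
  obtain ⟨φ, hφ, hφv, hφX⟩ := hj.exists_factor _ hinj (fun x => (⟨⟨x.1, hXA x.2⟩⟩ : ULift.{v} A'))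
    (fun _ _ => rfl) fun _ _ => rfl
  obtain ⟨ψ, hψ, -, hψX⟩ :=
    hj.isInjective.exists_extension_tightSpan hj.isometry.lipschitz hj.isActionPreserving
  have hφA : ∀ h, (φ h).down.1 ∈ A := fun h => (φ h).down.2
  have hφj : ∀ x, (φ (j x)).down.1 = x.1 := fun x => by
    have h := congrFun hφX x
    rw [Function.comp_apply] at h
    rw [← h]
  choose F hF using fun t => (hτr ▸ hφA (ψ t) : (φ (ψ t)).down.1 ∈ Set.range τ)
  have hid : ∀ t, F t = t := TightSpan.map_eq_of_lipschitz
    (.of_dist_le_mul fun s t => by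
      rw [← hτ.dist_eq, hF, hF]
      exact (hφ.dist_eq (ψ s) (ψ t)).trans_le (hψ.dist_le_mul s t))
    fun x => hτ.injective (by rw [hF, hψX, hφj, hτX])
  refine ⟨fun h => (φ h).down.1, fun x y => hφ x y,
    fun r h => congrArg (fun a : ULift.{v} A' => a.down.1) (hφv r h), hφj,
    (Set.range_subset_iff.2 hφA).antisymm fun a ha => ?_⟩
  rw [← hτr] at ha
  obtain ⟨t, rfl⟩ := ha
  exact ⟨ψ t, (hF t).symm.trans (congrArg τ (hid t))⟩

/-! ### Injective hulls of additive cones -/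

theorem mainTheorem3 {n : ℕ} [NeZero n] (X : AdditiveCone n)
    (hX : (X : Set (Fin n → ℝ)).Nonempty) :
    -- the tight span, with the canonical map, is the injective hull of `X`
    IsInjectiveHull.{v, 0, 0} (TightSpan.embed : X → TightSpan X) ∧
    -- any ambitropical hull corresponds to the tight span
    (∀ A : Set (Fin n → ℝ), IsAmbitropicalHull (X : Set (Fin n → ℝ)) A →
      ∃ φ : TightSpan X ≃ᵢ A,
        (∀ (r : ℝ) (f : TightSpan X), (φ (r +ᵥ f) : Fin n → ℝ) = r +ᵥ (φ f : Fin n → ℝ)) ∧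
        ∀ x : X, (φ (TightSpan.embed x) : Fin n → ℝ) = x) ∧
    -- and more generally to every injective hull of `X`
    (∀ A : Set (Fin n → ℝ), IsAmbitropicalHull (X : Set (Fin n → ℝ)) A →
      ∀ (H : Type u) [MetricSpace H] [AddAction ℝ H] (j : X → H), IsInjectiveHull.{v, u, 0} j →
        ∃ φ : H ≃ᵢ A,
          (∀ (r : ℝ) (h : H), (φ (r +ᵥ h) : Fin n → ℝ) = r +ᵥ (φ h : Fin n → ℝ)) ∧
          ∀ x : X, (φ (j x) : Fin n → ℝ) = x) ∧
    -- explicit construction of ambitropical hulls, hence of the injective hull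
    IsAmbitropicalHull (X : Set (Fin n → ℝ))
      (Set.range (projMax (X : Set (Fin n → ℝ)) ∘ projMin (X : Set (Fin n → ℝ)))) ∧
    IsAmbitropicalHull (X : Set (Fin n → ℝ))
      (Set.range (projMin (X : Set (Fin n → ℝ)) ∘ projMax (X : Set (Fin n → ℝ)))) := by
  have hB := isAmbitropicalHull_range_projMax_projMin hX
  obtain ⟨τ, hτ, hτv, -, hτr⟩ := exists_tightSpan_map hX hB
  have : IsRealActionSpace (TightSpan X) := isRealActionSpace_of_isometry hτ hτv
  refine ⟨TightSpan.isInjectiveHull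
    ((isConeRetraction_projMax_projMin hX).isInjectiveActionSpace hτ hτv hτr), fun A hA => ?_,
    fun A hA H _ _ j hj => ?_, hB, isAmbitropicalHull_range_projMin_projMax hX⟩
  · obtain ⟨φ, hφ, hφv, hφX, hφr⟩ := exists_tightSpan_map hX hA
    obtain ⟨e, he⟩ := hφ.exists_isometryEquiv_of_range_eq hφr
    exact ⟨e, fun r f => by rw [he, he, hφv], fun x => by rw [he, hφX]⟩
  · obtain ⟨φ, hφ, hφv, hφX, hφr⟩ := hj.exists_map hX hA
    obtain ⟨e, he⟩ := hφ.exists_isometryEquiv_of_range_eq hφr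
    exact ⟨e, fun r f => by rw [he, he, hφv], fun x => by rw [he, hφX]⟩
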